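/- **Setting.** Let $\mathbb W$ be the class of tracial $W^*$-algebras $\mathcal A=(A,\tau)$ (with $\tau$ a faithful normal tracial state) with separable predual. Let $L^2(\mathcal A)$ be the completion of $A$ for $\langle x,y\rangle=\tau(x^*y)$, and $L^2(\mathcal A)^d_{\rm sa}$ the real Hilbert space of self-adjoint $d$-tuples. A tracial $W^*$-embedding $\iota:\mathcal A\to\mathcal B$ is a unital trace-preserving $*$-homomorphism; its extension to $L^2$ (applied componentwise to tuples) is again denoted $\iota$, and $E:L^2(\mathcal B)^d_{\rm sa}\to L^2(\mathcal A)^d_{\rm sa}$ is its adjoint. *Costs.* Let $L_{\mathcal A}:L^2(\mathcal A)^d_{\rm sa}\times L^2(\mathcal A)^d_{\rm sa}\to\mathbb R$ and $g_{\mathcal A}:L^2(\mathcal A)^d_{\rm sa}\to\mathbb R$ ($\mathcal A\in\mathbb W$) satisfy, for all $\mathcal A$ and all embeddings $\iota:\mathcal A\to\mathcal B$: 1. $L_{\mathcal B}(\iota X,\iota\alpha)=L_{\mathcal A}(X,\alpha)$ and $g_{\mathcal B}(\iota X)=g_{\mathcal A}(X)$; 2. $\alpha\mapsto L_{\mathcal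 A}(X,\alpha)$ is convex and $L_{\mathcal A}(X,E\alpha)\le L_{\mathcal B}(\iota X,\alpha)$; 3. $L_{\mathcal A}$ is uniformly continuous on bounded sets; 4. for some $C_1,C_2>0$ independent of $\mathcal A$: $-C_1+C_1^{-1}\|\alpha\|^2\le L_{\mathcal A}(X,\alpha)\le C_1(1+\|X\|+\|\alpha\|^2)$, $-C_1\le g_{\mathcal A}(X)\le C_1(1+\|X\|)$, and $L_{\mathcal A}(\cdot,\alpha)$ and $g_{\mathcal A}$ are $C_2$-Lipschitz (all norms are $L^2$-norms); 5. $L_{\mathcal A}$ is jointly convex, $g_{\mathcal A}$ is convex, $L_{\mathcal A}(EX,E\alpha)\le L_{\mathcal B}(X,\alpha)$ and $g_{\mathcal A}(EX)\le g_{\mathcal B}(X)$. *Controls.* Let $W^0$ be a standard real Brownian motion on $[0,T]$ on a complete probability space $(\Omega,\mathcal F,\mathbb P)$, with $\mathcal F_t$ the completed $\sigma$-algebra generated by $W^0_s$, $s\le t$, and $\mathcal F=\mathcal F_T$. Let $\mathcal A\in\mathbb W$, $t_0\in[0,T]$ and $x_0\in L^2(\mathcal A)^d_{\rm sa}$. An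 admissible policy $\widetilde\alpha\in\mathbb A^{t_0,T}_{\mathcal A,x_0}$ consists of an increasing family $(\mathcal A_t)_{t\in[t_0,T]}$ of $W^*$-subalgebras of $\mathcal A$ with $x_0\in L^2(\mathcal A_{t_0})^d_{\rm sa}$; a $d$-dimensional free Brownian motion $(S_t)_{t\in[t_0,T]}$ compatible with it (norm-continuous, self-adjoint and adapted, $S_{t_0}=0$; for $s\le t$ the components of $S_t-S_s$ are freely independent and semicircular of mean $0$ and variance $t-s$, and $S_t-S_s$ is freely independent of $\mathcal A_s$); and a process $(\alpha_t)_{t\in[t_0,T]}$ with $(\alpha_t)_{t\in[t_0,s]}\in L^2\big([t_0,s]\times(\Omega,\mathcal F_s,\mathbb P);L^2(\mathcal A_s)^d_{\rm sa}\big)$ for every $s\in[t_0,T]$. For $\beta_C,\beta_F\ge0$ put $$X_t[\widetilde\alpha]=x_0+\int_{t_0}^t\alpha_s\,ds+\beta_C(W^0_t-W^0_{t_0})\,(1,\dots,1)+\beta_F(S_t-S_{t_0}),$$ $$J(\widetilde\alpha)=\int_{t_0}^TL_{\mathcal A}(X_t[\widetilde\alpha],\alpha_t)\,dt+g_{\mathcal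 A}(X_T[\widetilde\alpha]),\qquad \widetilde V_{\mathcal A}(t_0,x_0)=\inf_{\widetilde\alpha\in\mathbb A^{t_0,T}_{\mathcal A,x_0}}\mathbb E[J(\widetilde\alpha)],$$ with $\inf\emptyset=+\infty$. **Lemma.** Suppose $\beta_C=0$. Then for every admissible $\widetilde\alpha$ the function $t\mapsto L_{\mathcal A}(X_t[\widetilde\alpha],\alpha_t)$ is almost surely integrable on $[t_0,T]$ and $J(\widetilde\alpha)$ is $\mathbb P$-integrable, and $$\widetilde V_{\mathcal A}(t_0,x_0)=\inf\big\{J(\widetilde\alpha):\ \widetilde\alpha\in\mathbb A^{t_0,T}_{\mathcal A,x_0},\ \alpha \text{ is classically deterministic (does not depend on } \omega\in\Omega)\big\},$$ where $J(\widetilde\alpha)$ is a non-random number for deterministic $\alpha$, so that no expectation is needed. -/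

import Mathlib

open MeasureTheory ProbabilityTheory Set Topology
open scoped ComplexOrder ENNReal NNReal

noncomputable section

namespace FreeControl

/-! ## Tracial W*-algebras and their L²-spaces -/

/-- A tracial W*-algebra with separable predual: a unital C*-algebra which is (isometrically
isomorphic to) the dual of a separable Banach space, together with a faithful normal tracial
state. By uniqueness of the predual nothing depends on the chosen predual.
The order is the usual one, `0 ≤ x ↔ x` is a sum of elements `y* y`. -/
structure TracialWStarAlgebra where
  carrier : Type
  [cstarAlgebra : CStarAlgebra carrier]
  [partialOrder : PartialOrder carrier]
  [starOrderedRing : StarOrderedRing carrier]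
  Predual : Type
  [predualGroup : NormedAddCommGroup Predual]
  [predualSpace : NormedSpace ℂ Predual]
  [predualComplete : CompleteSpace Predual]
  [predualSeparable : TopologicalSpace.SeparableSpace Predual]
  toDual : carrier ≃ₗᵢ[ℂ] StrongDual ℂ Predual
  /-- the trace, a positive linear functional -/
  trace : carrier →ₚ[ℂ] ℂ
  trace_one : trace 1 = 1
  trace_faithful : ∀ x : carrier, trace (star x * x) = 0 → x = 0
  /-- normality: the trace belongs to the predual -/
  trace_normal : ∃ φ : Predual, ∀ x : carrier, trace x = toDual x φ
  trace_mul_comm : ∀ x y : carrier, trace (x * y) = trace (y * x)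

namespace TracialWStarAlgebra

instance : CoeSort TracialWStarAlgebra Type := ⟨carrier⟩

attribute [instance] cstarAlgebra partialOrder starOrderedRing predualGroup predualSpace
  predualComplete predualSeparable

variable (A : TracialWStarAlgebra)

/-- The Hilbert space `L²(A)`: the completion of `A` for `⟨x, y⟩ = τ(x* y)`. -/
def L2 : Type := A.trace.GNS

instance : NormedAddCommGroup A.L2 := inferInstanceAs (NormedAddCommGroup A.trace.GNS)
instance : InnerProductSpace ℂ A.L2 := inferInstanceAs (InnerProductSpace ℂ A.trace.GNS)
instance : InnerProductSpace ℝ A.L2 := InnerProductSpace.complexToReal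
instance : CompleteSpace A.L2 := inferInstanceAs (CompleteSpace A.trace.GNS)

/-- The canonical map `A → L²(A)`. -/
def toL2 : A →ₗ[ℂ] A.L2 :=
  (UniformSpace.Completion.toComplₗᵢ (𝕜 := ℂ) (E := A.trace.PreGNS)).toLinearMap ∘ₗ
    A.trace.toPreGNS.toLinearMap

variable {A}

/-- `L²(B)_sa` inside `L²(A)`, for a *-subalgebra `B` of `A`: the closure of the self-adjoint
elements of `B`. -/
def saL2 (B : StarSubalgebra ℂ A) : Submodule ℝ A.L2 :=
  ((selfAdjoint.submodule ℝ A ⊓ (Subalgebra.toSubmodule B.toSubalgebra).restrictScalars ℝ).map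
    (A.toL2.restrictScalars ℝ)).topologicalClosure

variable (A)

/-- `L²(A)_sa`, a real Hilbert space. -/
abbrev L2sa : Type := saL2 (⊤ : StarSubalgebra ℂ A)

instance : CompleteSpace A.L2sa :=
  (Submodule.isClosed_topologicalClosure _).completeSpace_coe

/-- `L²(A)_sa^d` with its Hilbert norm `(∑ ‖X^j‖²)^{1/2}`. -/
abbrev L2saTuple (d : ℕ) (A : TracialWStarAlgebra) : Type := PiLp 2 (fun _ : Fin d => A.L2sa)

variable {A}

lemma toL2_mem_saL2 {B : StarSubalgebra ℂ A} {x : A} (hx : IsSelfAdjoint x) (hB : x ∈ B) :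
    A.toL2 x ∈ saL2 B :=
  Submodule.le_topologicalClosure _ ⟨x, ⟨hx, hB⟩, rfl⟩

/-- The canonical map from bounded self-adjoint `d`-tuples to `L²(A)_sa^d`. -/
def tupleToL2 {d : ℕ} (x : Fin d → selfAdjoint A) : L2saTuple d A :=
  WithLp.toLp 2 fun j => ⟨A.toL2 (x j : A), toL2_mem_saL2 (x j).2 trivial⟩

/-! ## Sub-von Neumann algebras, free independence -/

/-- A unital *-subalgebra is a W*-subalgebra if it is closed in the weak-* topology. -/
def IsWStarSubalgebra (B : StarSubalgebra ℂ A) : Prop :=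
  IsClosed ((fun x : A => StrongDual.toWeakDual (A.toDual x)) '' (B : Set A))

/-- `W*(s)`: the smallest W*-subalgebra containing `s`. -/
def wStarGenerated (s : Set A) : StarSubalgebra ℂ A :=
  sInf {B | IsWStarSubalgebra B ∧ s ⊆ B}

/-- Free independence of a family of *-subalgebras: alternating products of centered elements
are centered. -/
def FreelyIndependent {J : Type} (B : J → StarSubalgebra ℂ A) : Prop :=
  ∀ (n : ℕ) (j : Fin (n + 1) → J), (∀ k : Fin n, j k.castSucc ≠ j k.succ) →
    ∀ a : Fin (n + 1) → A, (∀ k, a k ∈ B (j k)) →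
      A.trace (List.ofFn fun k => a k - algebraMap ℂ A (A.trace (a k))).prod = 0

/-- `x` is semicircular with mean `0` and variance `v`: its moments are those of the semicircle
law on `[-2√v, 2√v]`. -/
def IsSemicircular (x : A) (v : ℝ) : Prop :=
  IsSelfAdjoint x ∧ ∀ m : ℕ, A.trace (x ^ (2 * m)) = ((catalan m * v ^ m : ℝ) : ℂ) ∧
    A.trace (x ^ (2 * m + 1)) = 0

/-- A free filtration on `[t₀, t₁]`: an increasing family of W*-subalgebras. -/
def IsFreeFiltration (t₀ t₁ : ℝ) (F : ℝ → StarSubalgebra ℂ A) : Prop :=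
  (∀ t ∈ Icc t₀ t₁, IsWStarSubalgebra (F t)) ∧ MonotoneOn F (Icc t₀ t₁)

/-- A `d`-dimensional free Brownian motion on `[t₀, t₁]` compatible with the free
filtration `F`. -/
structure IsFreeBrownianMotion {d : ℕ} (t₀ t₁ : ℝ) (F : ℝ → StarSubalgebra ℂ A)
    (S : ℝ → Fin d → selfAdjoint A) : Prop where
  continuousOn : ContinuousOn S (Icc t₀ t₁)
  initial : S t₀ = 0
  semicircular : ∀ s ∈ Icc t₀ t₁, ∀ t ∈ Icc t₀ t₁, s ≤ t → ∀ l,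
    IsSemicircular ((S t l : A) - (S s l : A)) (t - s)
  free_components : ∀ s ∈ Icc t₀ t₁, ∀ t ∈ Icc t₀ t₁, s ≤ t →
    FreelyIndependent fun l => wStarGenerated {(S t l : A) - (S s l : A)}
  adapted : ∀ t ∈ Icc t₀ t₁, ∀ l, (S t l : A) ∈ F t
  free_increments : ∀ s ∈ Icc t₀ t₁, ∀ t ∈ Icc t₀ t₁, s ≤ t →
    FreelyIndependent ![wStarGenerated (range fun l => (S t l : A) - (S s l : A)), F s]

end TracialWStarAlgebra

open TracialWStarAlgebra

/-! ## Tracial embeddings and conditional expectations -/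

/-- A tracial W*-embedding: a unital trace-preserving *-homomorphism. It is automatically
injective and weak-* continuous. -/
structure TracialEmbedding (A B : TracialWStarAlgebra) extends A →⋆ₐ[ℂ] B where
  trace_map : ∀ x : A, B.trace (toFun x) = A.trace x

namespace TracialEmbedding

variable {A B : TracialWStarAlgebra} (ι : TracialEmbedding A B)

/-- The embedding as an `L²`-contractive map before completion. -/
def preL2 : A.trace.PreGNS →L[ℂ] B.trace.PreGNS :=
  (B.trace.toPreGNS.toLinearMap ∘ₗ ι.toStarAlgHom.toAlgHom.toLinearMap ∘ₗ
    A.trace.ofPreGNS.toLinearMap).mkContinuous 1 fun x => by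
      have h : B.trace (star (ι.toStarAlgHom (A.trace.ofPreGNS x)) *
          ι.toStarAlgHom (A.trace.ofPreGNS x)) =
          A.trace (star (A.trace.ofPreGNS x) * A.trace.ofPreGNS x) := by
        rw [← map_star, ← map_mul]
        exact ι.trace_map _
      rw [one_mul, PositiveLinearMap.preGNS_norm_def, PositiveLinearMap.preGNS_norm_def]
      exact (congrArg (fun z : ℂ => √z.re) h).le

/-- The extension `ι : L²(A) → L²(B)`. -/
def mapL2 : A.L2 →L[ℂ] B.L2 := ι.preL2.completion

lemma mapL2_toL2 (x : A) : ι.mapL2 (A.toL2 x) = B.toL2 (ι.toStarAlgHom x) :=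
  ContinuousLinearMap.completion_apply_coe ι.preL2 (A.trace.toPreGNS x)

lemma mapL2_mem (x : A.L2sa) : ι.mapL2 x ∈ saL2 (⊤ : StarSubalgebra ℂ B) := by
  have h : MapsTo ι.mapL2 (closure _) (closure _) :=
    MapsTo.closure (s := (((selfAdjoint.submodule ℝ A ⊓ (Subalgebra.toSubmodule
      (⊤ : StarSubalgebra ℂ A).toSubalgebra).restrictScalars ℝ).map
      (A.toL2.restrictScalars ℝ) : Submodule ℝ A.L2) : Set A.L2))
      (t := (((selfAdjoint.submodule ℝ B ⊓ (Subalgebra.toSubmodule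
      (⊤ : StarSubalgebra ℂ B).toSubalgebra).restrictScalars ℝ).map
      (B.toL2.restrictScalars ℝ) : Submodule ℝ B.L2) : Set B.L2)) ?_ ι.mapL2.continuous
  · exact h x.2
  · rintro _ ⟨y, ⟨hy, -⟩, rfl⟩
    refine ⟨ι.toStarAlgHom y, ⟨?_, trivial⟩, (ι.mapL2_toL2 y).symm⟩
    exact IsSelfAdjoint.map (show IsSelfAdjoint y from hy) ι.toStarAlgHom

/-- The restriction `ι : L²(A)_sa → L²(B)_sa`. -/
def mapL2sa : A.L2sa →L[ℝ] B.L2sa :=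
  ((ι.mapL2.restrictScalars ℝ).comp (saL2 (⊤ : StarSubalgebra ℂ A)).subtypeL).codRestrict
    (saL2 (⊤ : StarSubalgebra ℂ B)) ι.mapL2_mem

/-- The componentwise extension `ι : L²(A)_sa^d → L²(B)_sa^d`. -/
def mapTuple (d : ℕ) : L2saTuple d A →L[ℝ] L2saTuple d B where
  toFun X := WithLp.toLp 2 fun j => ι.mapL2sa (X j)
  map_add' X Y := by ext j; simp
  map_smul' c X := by ext j; simp
  cont := by fun_prop

/-- The adjoint `E : L²(B)_sa^d → L²(A)_sa^d` of `ι`. -/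
def condExp (d : ℕ) : L2saTuple d B →L[ℝ] L2saTuple d A :=
  ContinuousLinearMap.adjoint (ι.mapTuple d)

end TracialEmbedding

/-! ## Common noise -/

section Noise

variable {Ω : Type*} {mΩ : MeasurableSpace Ω}

/-- `F_t`, the σ-algebra generated by `W_s`, `0 ≤ s ≤ t`, completed by the null sets. -/
abbrev noiseFiltration (P : Measure Ω) (W : ℝ → Ω → ℝ) (t : ℝ) : MeasurableSpace Ω :=
  (⨆ s ∈ Icc (0 : ℝ) t, (borel ℝ).comap (W s)) ⊔ MeasurableSpace.generateFrom {N | P N = 0}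

/-- `W` is a standard Brownian motion on `[0, T]` on the probability space `(Ω, P)`, whose
σ-algebra is the (completed) one generated by `W`. -/
structure IsCommonNoise (P : Measure Ω) (T : ℝ) (W : ℝ → Ω → ℝ) : Prop where
  isProbabilityMeasure : IsProbabilityMeasure P
  generated : mΩ = noiseFiltration P W T
  initial : ∀ᵐ ω ∂P, W 0 ω = 0
  gaussian_increments : ∀ s ∈ Icc 0 T, ∀ t ∈ Icc 0 T, s ≤ t →
    HasLaw (fun ω => W t ω - W s ω) (gaussianReal 0 (t - s).toNNReal) P
  indep_increments : HasIndepIncrements (fun t : Icc (0 : ℝ) T => W t) P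

end Noise

/-! ## Control policies -/

/-- A policy: a control process, a family of subalgebras and a free noise. -/
structure Policy (d : ℕ) (A : TracialWStarAlgebra) (Ω : Type*) where
  control : ℝ → Ω → L2saTuple d A
  filtration : ℝ → StarSubalgebra ℂ A
  noise : ℝ → Fin d → selfAdjoint A

namespace Policy

variable {d : ℕ} {A : TracialWStarAlgebra} {Ω : Type*} {mΩ : MeasurableSpace Ω}

/-- Admissible policies for the control sets `𝔸_A = L²(A)_sa^d`. Condition `progressive` says
that for all `s`, the control on `[t₀, s]` is an element of
`L²([t₀, s] × (Ω, F_s, P); L²(A_s)_sa^d)`. -/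
structure IsAdmissible (P : Measure Ω) (W : ℝ → Ω → ℝ) (t₀ t₁ : ℝ) (x₀ : L2saTuple d A)
    (π : Policy d A Ω) : Prop where
  filtration : IsFreeFiltration t₀ t₁ π.filtration
  initial_mem : ∀ l, (x₀ l : A.L2) ∈ saL2 (π.filtration t₀)
  freeBrownian : IsFreeBrownianMotion t₀ t₁ π.filtration π.noise
  progressive : ∀ s ∈ Icc t₀ t₁,
    MemLp (fun p : ℝ × Ω => π.control p.1 p.2) 2 ((volume.restrict (Icc t₀ s)).prod P) ∧
    AEStronglyMeasurable[(borel ℝ).prod (noiseFiltration P W s)]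
      (fun p : ℝ × Ω => π.control p.1 p.2) ((volume.restrict (Icc t₀ s)).prod P) ∧
    ∀ᵐ p ∂((volume.restrict (Icc t₀ s)).prod P),
      ∀ l, (π.control p.1 p.2 l : A.L2) ∈ saL2 (π.filtration s)

/-- The control does not depend on the classical sample. -/
def IsDeterministic (π : Policy d A Ω) : Prop :=
  ∃ a : ℝ → L2saTuple d A, ∀ t ω, π.control t ω = a t

/-- The solution of `dX = α dt + β_C 1 dW + β_F dS`, `X_{t₀} = x₀`, along the sample `ω`. -/
def state (W : ℝ → Ω → ℝ) (βC βF t₀ : ℝ) (x₀ : L2saTuple d A) (π : Policy d A Ω)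
    (t : ℝ) (ω : Ω) : L2saTuple d A :=
  x₀ + (∫ s in t₀..t, π.control s ω) + (βC * (W t ω - W t₀ ω)) • tupleToL2 (fun _ => 1) +
    βF • tupleToL2 (π.noise t - π.noise t₀)

/-- The running cost at time `t` along the sample `ω`. -/
def runningCost (L : ∀ A : TracialWStarAlgebra, L2saTuple d A → L2saTuple d A → ℝ)
    (W : ℝ → Ω → ℝ) (βC βF t₀ : ℝ) (x₀ : L2saTuple d A) (π : Policy d A Ω) (ω : Ω) (t : ℝ) : ℝ :=
  L A (π.state W βC βF t₀ x₀ t ω) (π.control t ω)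

/-- The cost `∫_{t₀}^T L(X_t, α_t) dt + g(X_T)` along the sample `ω`. -/
def cost (L : ∀ A : TracialWStarAlgebra, L2saTuple d A → L2saTuple d A → ℝ)
    (g : ∀ A : TracialWStarAlgebra, L2saTuple d A → ℝ)
    (W : ℝ → Ω → ℝ) (βC βF t₀ T : ℝ) (x₀ : L2saTuple d A) (π : Policy d A Ω) (ω : Ω) : ℝ :=
  (∫ t in t₀..T, π.runningCost L W βC βF t₀ x₀ ω t) + g A (π.state W βC βF t₀ x₀ T ω)

end Policy

/-- The value function `Ṽ_A(t₀, x₀)`, the infimum of the expected costs; it is `+∞` if there is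
no admissible policy. -/
def value {d : ℕ} {A : TracialWStarAlgebra} {Ω : Type*} {mΩ : MeasurableSpace Ω}
    (P : Measure Ω) (W : ℝ → Ω → ℝ)
    (L : ∀ A : TracialWStarAlgebra, L2saTuple d A → L2saTuple d A → ℝ)
    (g : ∀ A : TracialWStarAlgebra, L2saTuple d A → ℝ)
    (βC βF T t₀ : ℝ) (x₀ : L2saTuple d A) : EReal :=
  sInf {c : EReal | ∃ π : Policy d A Ω, π.IsAdmissible P W t₀ T x₀ ∧
    c = ((∫ ω, π.cost L g W βC βF t₀ T x₀ ω ∂P : ℝ) : EReal)}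

/-! ## Assumptions on the costs -/

/-- Assumption A on the running and terminal costs, with control sets `𝔸_A = L²(A)_sa^d`. -/
structure AssumptionA {d : ℕ}
    (L : ∀ A : TracialWStarAlgebra, L2saTuple d A → L2saTuple d A → ℝ)
    (g : ∀ A : TracialWStarAlgebra, L2saTuple d A → ℝ) : Prop where
  L_tracial : ∀ (A B : TracialWStarAlgebra) (ι : TracialEmbedding A B) (X α : L2saTuple d A),
    L B (ι.mapTuple d X) (ι.mapTuple d α) = L A X α
  g_tracial : ∀ (A B : TracialWStarAlgebra) (ι : TracialEmbedding A B) (X : L2saTuple d A),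
    g B (ι.mapTuple d X) = g A X
  L_convex : ∀ (A : TracialWStarAlgebra) (X : L2saTuple d A), ConvexOn ℝ univ (L A X)
  L_eConvex : ∀ (A B : TracialWStarAlgebra) (ι : TracialEmbedding A B) (X : L2saTuple d A)
    (α : L2saTuple d B), L A X (ι.condExp d α) ≤ L B (ι.mapTuple d X) α
  L_uniformContinuousOn : ∀ (A : TracialWStarAlgebra) (R : ℝ),
    UniformContinuousOn (fun p : L2saTuple d A × L2saTuple d A => L A p.1 p.2)
      (Metric.closedBall 0 R)
  growth : ∃ C₁ : ℝ, 0 < C₁ ∧ ∀ (A : TracialWStarAlgebra) (X α : L2saTuple d A),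
    (-C₁ + 1 / C₁ * ‖α‖ ^ 2 ≤ L A X α ∧ L A X α ≤ C₁ * (1 + ‖X‖ + ‖α‖ ^ 2)) ∧
    (-C₁ ≤ g A X ∧ g A X ≤ C₁ * (1 + ‖X‖))
  lipschitz : ∃ C₂ : ℝ, 0 < C₂ ∧ ∀ (A : TracialWStarAlgebra) (X₁ X₂ α : L2saTuple d A),
    |L A X₁ α - L A X₂ α| ≤ C₂ * ‖X₁ - X₂‖ ∧ |g A X₁ - g A X₂| ≤ C₂ * ‖X₁ - X₂‖

/-- Assumption B on the costs: joint `E`-convexity of `L` and `E`-convexity of `g`. -/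
structure AssumptionB {d : ℕ}
    (L : ∀ A : TracialWStarAlgebra, L2saTuple d A → L2saTuple d A → ℝ)
    (g : ∀ A : TracialWStarAlgebra, L2saTuple d A → ℝ) : Prop where
  L_convex : ∀ A : TracialWStarAlgebra,
    ConvexOn ℝ univ (fun p : L2saTuple d A × L2saTuple d A => L A p.1 p.2)
  L_eConvex : ∀ (A B : TracialWStarAlgebra) (ι : TracialEmbedding A B) (X α : L2saTuple d B),
    L A (ι.condExp d X) (ι.condExp d α) ≤ L B X α
  g_convex : ∀ A : TracialWStarAlgebra, ConvexOn ℝ univ (g A)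
  g_eConvex : ∀ (A B : TracialWStarAlgebra) (ι : TracialEmbedding A B) (X : L2saTuple d B),
    g A (ι.condExp d X) ≤ g B X

end FreeControl

end

/-! With `βC = 0` the classical sample `ω` enters the state and the cost only through the control.
Fixing `ω` in the control and keeping the free filtration and free Brownian motion (`freeze`) thus
gives a deterministic policy whose sure cost is the cost of the original policy at `ω`. For almost
every `ω` it is admissible (`ae_freeze`), and an integrable random variable is at most its mean at
some point outside any given null set, so some frozen policy costs no more than the expected cost.
The converse inequality holds because a deterministic policy has constant cost. The analytic work is
joint measurability of the state and domination of the costs, which give integrability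
(`integrable_cost`). -/

noncomputable section

namespace FreeControl

/-! ### Continuity of the map into `L²` -/

namespace TracialWStarAlgebra

variable {A : TracialWStarAlgebra}

/-- The GNS vector of `a` is left multiplication by `a` applied to the vector of `1`. This turns
norm continuity of the free Brownian motion into `L²` continuity. -/
lemma norm_toL2_le (a : A) : ‖A.toL2 a‖ ≤ ‖A.trace.toPreGNS (1 : A)‖ * ‖a‖ := by
  have h₁ : ‖A.toL2 a‖ = ‖A.trace.toPreGNS a‖ :=
    UniformSpace.Completion.norm_coe (A.trace.toPreGNS a)
  have h₂ : A.trace.toPreGNS a = A.trace.leftMulMapPreGNS a (A.trace.toPreGNS 1) := by simp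
  rw [h₁, h₂, mul_comm]
  exact (A.trace.leftMulMapPreGNS a).le_of_opNorm_le
    (LinearMap.mkContinuous_norm_le _ (norm_nonneg a) _) _

lemma continuous_toL2 : Continuous A.toL2 :=
  AddMonoidHomClass.continuous_of_bound A.toL2 _ norm_toL2_le

lemma continuous_tupleToL2 {d : ℕ} :
    Continuous (tupleToL2 : (Fin d → selfAdjoint A) → L2saTuple d A) := by
  refine (PiLp.continuous_toLp 2 _).comp (continuous_pi fun j => Continuous.subtype_mk ?_ _)
  exact continuous_toL2.comp (continuous_subtype_val.comp (continuous_apply j))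

lemma saL2_mono {B C : StarSubalgebra ℂ A} (h : B ≤ C) : saL2 B ≤ saL2 C :=
  Submodule.topologicalClosure_mono (Submodule.map_mono (inf_le_inf_left _ fun _ hx => h hx))

end TracialWStarAlgebra

open TracialWStarAlgebra

/-! ### Measurability of time integrals -/

section Measurability

variable {Ω : Type*} {mΩ : MeasurableSpace Ω} {P : Measure Ω} [SFinite P]
  {E : Type*} [NormedAddCommGroup E] [NormedSpace ℝ E]

/-- The primitive in time of a jointly measurable process is jointly measurable. -/
lemma aestronglyMeasurable_primitive {α : ℝ → Ω → E} {a b : ℝ}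
    (h : AEStronglyMeasurable (fun p : ℝ × Ω => α p.1 p.2)
      ((volume.restrict (Icc a b)).prod P)) :
    AEStronglyMeasurable (fun p : ℝ × Ω => ∫ s in a..p.1, α s p.2)
      ((volume.restrict (Icc a b)).prod P) := by
  -- The indicator of `D` moves the variable endpoint into the integrand, leaving a parameter
  -- integral over the fixed interval.
  let D : Set ((ℝ × Ω) × ℝ) := {z | a < z.2 ∧ z.2 ≤ z.1.1}
  have hD : MeasurableSet D :=
    (measurableSet_lt measurable_const measurable_snd).inter
      (measurableSet_le measurable_snd measurable_fst.fst)
  have hF : StronglyMeasurable (D.indicator fun z : (ℝ × Ω) × ℝ => h.mk _ (z.2, z.1.2)) :=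
    (h.stronglyMeasurable_mk.comp_measurable
      (measurable_snd.prodMk measurable_fst.snd)).indicator hD
  refine ⟨_, hF.integral_prod_right' (ν := volume.restrict (Icc a b)), ?_⟩
  have h₁ : ∀ᵐ p ∂((volume.restrict (Icc a b)).prod P), p.1 ∈ Icc a b :=
    Measure.quasiMeasurePreserving_fst.ae (ae_restrict_mem measurableSet_Icc)
  have h₂ : ∀ᵐ p ∂((volume.restrict (Icc a b)).prod P), ∀ᵐ s ∂volume.restrict (Icc a b),
      α s p.2 = h.mk _ (s, p.2) :=
    Measure.quasiMeasurePreserving_snd.ae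
      (Measure.ae_ae_of_ae_prod (Measure.measurePreserving_swap.quasiMeasurePreserving.ae
        h.ae_eq_mk))
  filter_upwards [h₁, h₂] with p hp hp'
  have hsub : Ioc a p.1 ⊆ Icc a b := fun s hs => ⟨hs.1.le, hs.2.trans hp.2⟩
  have hind : ∀ s, D.indicator (fun z : (ℝ × Ω) × ℝ => h.mk _ (z.2, z.1.2)) (p, s) =
      (Ioc a p.1).indicator (fun s => h.mk _ (s, p.2)) s := fun s => rfl
  simp only [hind]
  rw [intervalIntegral.integral_of_le hp.1, integral_indicator measurableSet_Ioc,
    Measure.restrict_restrict measurableSet_Ioc, inter_eq_left.2 hsub]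
  exact integral_congr_ae (ae_mono (Measure.restrict_mono_set _ hsub) hp')

end Measurability

/-! ### Continuity and growth of the costs -/

section Costs

variable {d : ℕ} {L : ∀ A : TracialWStarAlgebra, L2saTuple d A → L2saTuple d A → ℝ}
  {g : ∀ A : TracialWStarAlgebra, L2saTuple d A → ℝ}

lemma AssumptionA.continuous_L (hA : AssumptionA L g) (A : TracialWStarAlgebra) :
    Continuous fun p : L2saTuple d A × L2saTuple d A => L A p.1 p.2 := by
  refine continuous_iff_continuousAt.2 fun p => ?_
  refine (hA.L_uniformContinuousOn A (‖p‖ + 1)).continuousOn.continuousAt ?_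
  refine Filter.mem_of_superset (Metric.ball_mem_nhds p one_pos) fun q hq => ?_
  rw [mem_closedBall_zero_iff]
  rw [Metric.mem_ball, dist_eq_norm] at hq
  linarith [norm_le_norm_add_norm_sub' q p]

lemma AssumptionA.continuous_g (hA : AssumptionA L g) (A : TracialWStarAlgebra) :
    Continuous (g A) := by
  obtain ⟨C, hC, h⟩ := hA.lipschitz
  refine (LipschitzWith.of_dist_le_mul (K := C.toNNReal) fun X Y => ?_).continuous
  rw [Real.coe_toNNReal _ hC.le, Real.dist_eq, dist_eq_norm]
  exact (h A X Y 0).2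

/-- Coercivity bounds the costs below by `-C`, so the upper growth bound also controls absolute
values. -/
lemma AssumptionA.exists_bound (hA : AssumptionA L g) :
    ∃ C : ℝ, 0 < C ∧ ∀ (A : TracialWStarAlgebra) (X α : L2saTuple d A),
      |L A X α| ≤ C * (1 + ‖X‖ + ‖α‖ ^ 2) ∧ |g A X| ≤ C * (1 + ‖X‖) := by
  obtain ⟨C, hC, h⟩ := hA.growth
  refine ⟨C, hC, fun A X α => ?_⟩
  obtain ⟨⟨h₁, h₂⟩, h₃, h₄⟩ := h A X α
  have hX : 0 ≤ C * ‖X‖ := by positivity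
  have hα : 0 ≤ C * ‖α‖ ^ 2 := by positivity
  have hα' : 0 ≤ 1 / C * ‖α‖ ^ 2 := by positivity
  exact ⟨abs_le.2 ⟨by linarith, h₂⟩, abs_le.2 ⟨by linarith, h₄⟩⟩

end Costs

/-! ### Freezing the sample, integrability and selection -/

namespace Policy

variable {d : ℕ} {A : TracialWStarAlgebra} {Ω : Type*} {mΩ : MeasurableSpace Ω}
  {P : Measure Ω} {W : ℝ → Ω → ℝ} {T βF t₀ : ℝ} {x₀ : L2saTuple d A} {π : Policy d A Ω}
  {L : ∀ A : TracialWStarAlgebra, L2saTuple d A → L2saTuple d A → ℝ}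
  {g : ∀ A : TracialWStarAlgebra, L2saTuple d A → ℝ}

lemma state_of_commonNoise_zero (t : ℝ) (ω : Ω) :
    π.state W 0 βF t₀ x₀ t ω =
      x₀ + (∫ s in t₀..t, π.control s ω) + βF • tupleToL2 (π.noise t - π.noise t₀) := by
  simp [state]

/-- The policy which follows the control of `π` along the fixed sample `ω`. -/
def freeze (π : Policy d A Ω) (ω : Ω) : Policy d A Ω where
  control t _ := π.control t ω
  filtration := π.filtration
  noise := π.noise

lemma isDeterministic_freeze (ω : Ω) : (π.freeze ω).IsDeterministic :=
  ⟨fun t => π.control t ω, fun _ _ => rfl⟩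

lemma cost_freeze (ω ω' : Ω) :
    (π.freeze ω).cost L g W 0 βF t₀ T x₀ ω' = π.cost L g W 0 βF t₀ T x₀ ω := by
  simp only [cost, runningCost, state_of_commonNoise_zero, freeze]

lemma IsDeterministic.cost_eq (h : π.IsDeterministic) (ω ω' : Ω) :
    π.cost L g W 0 βF t₀ T x₀ ω = π.cost L g W 0 βF t₀ T x₀ ω' := by
  obtain ⟨a, ha⟩ := h
  simp only [cost, runningCost, state_of_commonNoise_zero, ha]

lemma IsAdmissible.continuousOn_noise (h : π.IsAdmissible P W t₀ T x₀) :
    ContinuousOn (fun t => βF • tupleToL2 (π.noise t - π.noise t₀)) (Icc t₀ T) :=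
  (continuous_tupleToL2.comp_continuousOn
    (h.freeBrownian.continuousOn.sub continuousOn_const)).const_smul βF

variable [IsProbabilityMeasure P]

/-- Along almost every sample, the frozen control is adapted to the free filtration. -/
lemma IsAdmissible.ae_forall_mem_saL2 (h : π.IsAdmissible P W t₀ T x₀) :
    ∀ᵐ ω ∂P, ∀ s ∈ Icc t₀ T, ∀ᵐ t ∂volume.restrict (Icc t₀ s),
      ∀ l, (π.control t ω l : A.L2) ∈ saL2 (π.filtration s) := by
  -- The exceptional null set in `progressive` depends on the time `s`; restricting to rational
  -- times leaves a countable union.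
  have hq : ∀ᵐ ω ∂P, ∀ q : ℚ, (q : ℝ) ∈ Icc t₀ T → ∀ᵐ t ∂volume.restrict (Icc t₀ (q : ℝ)),
      ∀ l, (π.control t ω l : A.L2) ∈ saL2 (π.filtration q) := by
    refine ae_all_iff.2 fun q => ?_
    by_cases hq : (q : ℝ) ∈ Icc t₀ T
    · filter_upwards [Measure.ae_ae_of_ae_prod
        (Measure.measurePreserving_swap.quasiMeasurePreserving.ae (h.progressive q hq).2.2)]
        with ω hω _ using hω
    · exact ae_of_all _ fun ω hq' => absurd hq' hq
  filter_upwards [hq] with ω hω s hs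
  have hω' : ∀ᵐ t, ∀ q : ℚ, (q : ℝ) ∈ Icc t₀ T → t ∈ Icc t₀ (q : ℝ) →
      ∀ l, (π.control t ω l : A.L2) ∈ saL2 (π.filtration q) := by
    refine ae_all_iff.2 fun q => ?_
    by_cases hq : (q : ℝ) ∈ Icc t₀ T
    · filter_upwards [(ae_restrict_iff' measurableSet_Icc).1 (hω q hq)] with t ht _ using ht
    · exact ae_of_all _ fun t hq' => absurd hq' hq
  rw [ae_restrict_iff' measurableSet_Icc]
  -- Discarding the single time `t = s` leaves room for a rational between `t` and `s`; monotonicity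
  -- of the filtration then passes from that rational to `s`.
  filter_upwards [hω', Measure.ae_ne volume s] with t ht hts hmem l
  obtain ⟨q, hq₁, hq₂⟩ := exists_rat_btwn (lt_of_le_of_ne hmem.2 hts)
  have hqT : (q : ℝ) ∈ Icc t₀ T := ⟨hmem.1.trans hq₁.le, hq₂.le.trans hs.2⟩
  exact saL2_mono (h.filtration.2 hqT hs hq₂.le) (ht q hqT ⟨hmem.1, hq₁.le⟩ l)

/-- Freezing an admissible policy along almost every sample gives an admissible policy. -/
lemma IsAdmissible.ae_freeze (h : π.IsAdmissible P W t₀ T x₀) (hT : t₀ ≤ T) :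
    ∀ᵐ ω ∂P, (π.freeze ω).IsAdmissible P W t₀ T x₀ := by
  have hmem := (h.progressive T ⟨hT, le_rfl⟩).1
  have hmeas : ∀ᵐ ω ∂P, AEStronglyMeasurable (fun t => π.control t ω)
      (volume.restrict (Icc t₀ T)) := hmem.1.prodMk_right
  have hint := ((memLp_two_iff_integrable_sq_norm hmem.1).1 hmem).prod_left_ae
  filter_upwards [hmeas, hint, h.ae_forall_mem_saL2] with ω hω₁ hω₂ hω₃
  refine ⟨h.filtration, h.initial_mem, h.freeBrownian, fun s hs => ?_⟩
  have hLp : MemLp (fun t => π.control t ω) 2 (volume.restrict (Icc t₀ s)) :=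
    ((memLp_two_iff_integrable_sq_norm hω₁).2 hω₂).mono_measure
      (Measure.restrict_mono_set _ (Icc_subset_Icc_right hs.2))
  refine ⟨hLp.comp_fst P, ?_, Measure.quasiMeasurePreserving_fst.ae (hω₃ s hs)⟩
  -- A representative depending on time alone is measurable for every σ-algebra on `Ω`, in
  -- particular for the noise filtration at `s`.
  obtain ⟨a, ha, hae⟩ := hLp.1
  refine ⟨fun p => a p.1, ?_, Measure.quasiMeasurePreserving_fst.ae hae⟩
  exact ha.comp_measurable (@measurable_fst _ _ _ (noiseFiltration P W s))

lemma IsAdmissible.aestronglyMeasurable_state (h : π.IsAdmissible P W t₀ T x₀) (hT : t₀ ≤ T) :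
    AEStronglyMeasurable (fun p : ℝ × Ω => π.state W 0 βF t₀ x₀ p.1 p.2)
      ((volume.restrict (Icc t₀ T)).prod P) := by
  simp only [state_of_commonNoise_zero]
  have hmem := (h.progressive T ⟨hT, le_rfl⟩).1
  exact (aestronglyMeasurable_const.add (aestronglyMeasurable_primitive hmem.1)).add
    (h.continuousOn_noise.aestronglyMeasurable measurableSet_Icc).comp_fst

lemma IsAdmissible.aestronglyMeasurable_terminal_state (h : π.IsAdmissible P W t₀ T x₀)
    (hT : t₀ ≤ T) :
    AEStronglyMeasurable (fun ω => π.state W 0 βF t₀ x₀ T ω) P := by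
  simp only [state_of_commonNoise_zero, intervalIntegral.integral_of_le hT,
    ← integral_Icc_eq_integral_Ioc]
  have hmem := (h.progressive T ⟨hT, le_rfl⟩).1
  exact (aestronglyMeasurable_const.add hmem.1.prod_swap.integral_prod_right').add
    aestronglyMeasurable_const

/-- The states are dominated, uniformly in time, by an integrable random variable. -/
lemma IsAdmissible.exists_state_bound (h : π.IsAdmissible P W t₀ T x₀) (hT : t₀ ≤ T) :
    ∃ K : Ω → ℝ, Integrable K P ∧
      ∀ᵐ ω ∂P, ∀ t ∈ Icc t₀ T, ‖π.state W 0 βF t₀ x₀ t ω‖ ≤ K ω := by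
  have hmem := (h.progressive T ⟨hT, le_rfl⟩).1
  have hint := hmem.integrable one_le_two
  obtain ⟨C, hC⟩ := isCompact_Icc.exists_bound_of_continuousOn (h.continuousOn_noise (βF := βF))
  -- `C` bounds the free noise on the compact interval; the middle term is integrable since the
  -- control is `L²`, hence `L¹`, for a finite measure.
  refine ⟨fun ω => ‖x₀‖ + (∫ s in Icc t₀ T, ‖π.control s ω‖) + C,
    ((integrable_const _).add hint.norm.integral_prod_right).add (integrable_const _), ?_⟩
  filter_upwards [hint.norm.prod_left_ae] with ω hω t ht
  rw [state_of_commonNoise_zero]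
  refine (norm_add₃_le ..).trans (add_le_add (add_le_add le_rfl ?_) (hC t ht))
  refine (intervalIntegral.norm_integral_le_integral_norm ht.1).trans ?_
  rw [intervalIntegral.integral_of_le ht.1]
  exact setIntegral_mono_set hω (ae_of_all _ fun s => norm_nonneg _)
    (ae_of_all _ fun s hs => ⟨hs.1.le, hs.2.trans ht.2⟩)

lemma IsAdmissible.integrable_runningCost (h : π.IsAdmissible P W t₀ T x₀) (hT : t₀ ≤ T)
    (hA : AssumptionA L g) :
    Integrable (fun p : ℝ × Ω => π.runningCost L W 0 βF t₀ x₀ p.2 p.1)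
      ((volume.restrict (Icc t₀ T)).prod P) := by
  have hmem := (h.progressive T ⟨hT, le_rfl⟩).1
  obtain ⟨C, hC, hbd⟩ := hA.exists_bound
  obtain ⟨K, hK, hK'⟩ := h.exists_state_bound (βF := βF) hT
  -- Growth linear in the state and quadratic in the control matches an integrable `K` and a
  -- square-integrable control.
  have hdom : Integrable (fun p : ℝ × Ω => C * (1 + K p.2 + ‖π.control p.1 p.2‖ ^ 2))
      ((volume.restrict (Icc t₀ T)).prod P) :=
    (((integrable_const 1).add (hK.comp_snd _)).add
      ((memLp_two_iff_integrable_sq_norm hmem.1).1 hmem)).const_mul C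
  refine hdom.mono' ((hA.continuous_L A).comp_aestronglyMeasurable
    ((h.aestronglyMeasurable_state hT).prodMk hmem.1)) ?_
  filter_upwards [Measure.quasiMeasurePreserving_snd.ae hK',
    Measure.quasiMeasurePreserving_fst.ae (ae_restrict_mem measurableSet_Icc)] with p hp hpT
  refine (hbd A _ _).1.trans (mul_le_mul_of_nonneg_left ?_ hC.le)
  linarith [hp p.1 hpT]

lemma IsAdmissible.integrable_cost (h : π.IsAdmissible P W t₀ T x₀) (hT : t₀ ≤ T)
    (hA : AssumptionA L g) : Integrable (π.cost L g W 0 βF t₀ T x₀) P := by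
  obtain ⟨C, hC, hbd⟩ := hA.exists_bound
  obtain ⟨K, hK, hK'⟩ := h.exists_state_bound (βF := βF) hT
  refine Integrable.add ?_ ?_
  · simp only [intervalIntegral.integral_of_le hT, ← integral_Icc_eq_integral_Ioc]
    exact (h.integrable_runningCost hT hA).integral_prod_right
  · refine (((integrable_const 1).add hK).const_mul C).mono'
      ((hA.continuous_g A).comp_aestronglyMeasurable (h.aestronglyMeasurable_terminal_state hT)) ?_
    filter_upwards [hK'] with ω hω
    refine (hbd A _ 0).2.trans (mul_le_mul_of_nonneg_left ?_ hC.le)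
    simpa using hω T ⟨hT, le_rfl⟩

/-- A deterministic admissible policy does at least as well as a given admissible policy. -/
lemma IsAdmissible.exists_isDeterministic (h : π.IsAdmissible P W t₀ T x₀) (hT : t₀ ≤ T)
    (hA : AssumptionA L g) :
    ∃ ρ : Policy d A Ω, ρ.IsAdmissible P W t₀ T x₀ ∧ ρ.IsDeterministic ∧
      ∀ ω, ρ.cost L g W 0 βF t₀ T x₀ ω ≤ ∫ ω', π.cost L g W 0 βF t₀ T x₀ ω' ∂P := by
  -- The sample is chosen off the null set where the frozen policy fails to be admissible.
  obtain ⟨ω, hω, hle⟩ := exists_notMem_null_le_integral (h.integrable_cost hT hA)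
    (ae_iff.1 (h.ae_freeze hT))
  refine ⟨π.freeze ω, not_not.1 hω, isDeterministic_freeze ω, fun ω' => ?_⟩
  rwa [cost_freeze]

end Policy

end FreeControl

end

theorem mainTheorem7 {d : ℕ} {Ω : Type*} {mΩ : MeasurableSpace Ω} (P : Measure Ω)
    (W : ℝ → Ω → ℝ) (T : ℝ) (hW : FreeControl.IsCommonNoise P T W)
    (L : ∀ A : FreeControl.TracialWStarAlgebra,
      FreeControl.TracialWStarAlgebra.L2saTuple d A →
      FreeControl.TracialWStarAlgebra.L2saTuple d A → ℝ)
    (g : ∀ A : FreeControl.TracialWStarAlgebra,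
      FreeControl.TracialWStarAlgebra.L2saTuple d A → ℝ)
    (hA : FreeControl.AssumptionA L g) (hB : FreeControl.AssumptionB L g)
    (βC βF : ℝ) (hβC : βC = 0) (hβF : 0 ≤ βF)
    (A : FreeControl.TracialWStarAlgebra) (t₀ : ℝ) (ht₀ : t₀ ∈ Icc 0 T)
    (x₀ : FreeControl.TracialWStarAlgebra.L2saTuple d A) :
    -- all costs are well defined
    (∀ π : FreeControl.Policy d A Ω, π.IsAdmissible P W t₀ T x₀ →
      (∀ᵐ ω ∂P, IntervalIntegrable (π.runningCost L W βC βF t₀ x₀ ω) volume t₀ T) ∧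
      Integrable (π.cost L g W βC βF t₀ T x₀) P) ∧
    -- the value is the infimum of the sure costs of classically deterministic controls
    FreeControl.value P W L g βC βF T t₀ x₀ =
      sInf {c : EReal | ∃ π : FreeControl.Policy d A Ω, π.IsAdmissible P W t₀ T x₀ ∧
        π.IsDeterministic ∧ ∀ ω, c = (π.cost L g W βC βF t₀ T x₀ ω : EReal)} := by
  have := hW.isProbabilityMeasure
  subst hβC
  have hT : t₀ ≤ T := ht₀.2
  obtain ⟨ω₀⟩ := nonempty_of_isProbabilityMeasure P
  refine ⟨fun π hπ => ⟨?_, hπ.integrable_cost hT hA⟩, le_antisymm ?_ ?_⟩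
  · filter_upwards [(hπ.integrable_runningCost (βF := βF) hT hA).prod_left_ae] with ω hω
    exact (intervalIntegrable_iff_integrableOn_Icc_of_le hT).2 hω
  · refine le_sInf ?_
    rintro c ⟨π, hπ, hdet, hc⟩
    -- The constant cost is its own expectation, as `P` has total mass one.
    refine sInf_le ⟨π, hπ, ?_⟩
    rw [hc ω₀, integral_congr_ae (ae_of_all P fun ω => hdet.cost_eq ω ω₀)]
    simp
  · refine le_sInf ?_
    rintro c ⟨π, hπ, rfl⟩
    obtain ⟨ρ, hρ, hdet, hle⟩ := hπ.exists_isDeterministic (βF := βF) hT hA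
    exact sInf_le_of_le ⟨ρ, hρ, hdet, fun ω => congrArg _ (hdet.cost_eq ω₀ ω)⟩
      (EReal.coe_le_coe_iff.2 (hle ω₀))
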